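/- Let $M\subset\mathbb R^N$ be an oriented $m$-dimensional smooth (embedded) submanifold, of any dimension $m$ and any codimension. For $x\in M$ let $\tau_1,\dots,\tau_m$ be an orthonormal basis of the tangent space $T_xM$. The second fundamental form of $M$ at $x$ is $\mathrm{II}_x(a,b)=\big((a\cdot\partial)b\big)^{\perp}$ for $a,b\in T_xM$: the component normal to $M$ of the derivative at $x$ in direction $a$ of a tangent vector field with value $b$ at $x$. The mean curvature vector is its trace $\mathbf H(x)=\sum_{j=1}^m \mathrm{II}_x(\tau_j,\tau_j)$, and $M$ is called minimal if $\mathbf H\equiv 0$ on $M$. Multivectors are multiplied with the geometric (Clifford) product of $\mathbb R^N$, for which $v\,v=\langle v,v\rangle$ for vectors $v$. For a multivector-valued function $F$ on $M$ whose derivatives $(a\cdot\partial)F$ in all tangent directions $a$ exist, let $$\partial F=\sum_{j=1}^m \tau_j\,(\tau_j\cdot\partial)F,\qquad F\partial=\sum_{j=1}^m \big((\tau_j\cdot\partial)F\big)\,\tau_j .$$ $F$ is called left monogenic if all these directional derivatives exist and $\partial F\equiv0$ on $M$, and monogenic if, in addition, $F\partial\equiv 0$ on $M$. The Gauss map of $M$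 is the unit tangent $m$-blade field $\mathfrak T(x)=\tau_1\wedge\dots\wedge\tau_m$, where $\tau_1,\dots,\tau_m$ is a positively oriented orthonormal basis of $T_xM$ (for $m=0$, where an orientation of a point is a sign, $\mathfrak T(x)=\pm1$ is that sign). Then $M$ is minimal if and only if its Gauss map $\mathfrak T$ is monogenic, and also if and only if $\mathfrak T$ is left monogenic, that is, $\partial\mathfrak T\equiv0$. -/

import Mathlib

open Set Filter Topology Module
open scoped ContDiff

namespace GeometricCalculus

noncomputable section

/-- The Euclidean space `ℝ^N`. -/
abbrev Euc (N : ℕ) : Type := EuclideanSpace ℝ (Fin N)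

/-! ### The geometric algebra of `ℝ^N` -/

/-- The quadratic form `v ↦ ⟨v, v⟩` of the Euclidean space `ℝ^N`. -/
def normSqForm (N : ℕ) : QuadraticForm ℝ (Euc N) :=
  LinearMap.BilinMap.toQuadraticMap (innerₗ (Euc N))

/-- The multivectors of `ℝ^N`; multiplication is the geometric product, with `v * v = ⟨v, v⟩`
for vectors `v`. -/
abbrev Multivector (N : ℕ) : Type := CliffordAlgebra (normSqForm N)

/-- The canonical topology of the finite-dimensional real vector space of multivectors
(the one induced by any norm). -/
instance (N : ℕ) : TopologicalSpace (Multivector N) := moduleTopology ℝ (Multivector N)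

instance (N : ℕ) : IsModuleTopology ℝ (Multivector N) := ⟨rfl⟩

/-- A vector, regarded as a multivector. -/
def vec {N : ℕ} (v : Euc N) : Multivector N := CliffordAlgebra.ι (normSqForm N) v

/-- The exterior product `v₁ ∧ … ∧ vₘ` of vectors. The geometric algebra is identified with the
exterior algebra by the canonical linear isomorphism, the one for which
`v A = v ⌟ A + v ∧ A` for vectors `v` and multivectors `A`. -/
def wedge {m N : ℕ} (v : Fin m → Euc N) : Multivector N :=
  letI : Invertible (2 : ℝ) := invertibleOfNonzero two_ne_zero
  (CliffordAlgebra.equivExterior (normSqForm N)).symm (ExteriorAlgebra.ιMulti ℝ m v)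

/-! ### Submanifolds of `ℝ^N` -/

/-- `M ⊆ ℝ^N` is an `m`-dimensional smooth (embedded) submanifold: near each of its points a smooth
diffeomorphism `Φ` between open subsets of `ℝ^N` straightens it to an `m`-dimensional linear
subspace `L`. -/
def IsSmoothSubmanifold (m : ℕ) {N : ℕ} (M : Set (Euc N)) : Prop :=
  ∀ x ∈ M, ∃ (Φ : OpenPartialHomeomorph (Euc N) (Euc N)) (L : Submodule ℝ (Euc N)),
    x ∈ Φ.source ∧ finrank ℝ L = m ∧
    ContDiffOn ℝ ∞ Φ Φ.source ∧ ContDiffOn ℝ ∞ Φ.symm Φ.target ∧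
    ∀ y ∈ Φ.source, y ∈ M ↔ Φ y ∈ L

/-- `γ` is a curve in `M` with `γ(0) = x` and velocity `γ'(0) = a`. -/
def IsCurveWithVelocity {N : ℕ} {M : Set (Euc N)} (γ : ℝ → M) (x : M) (a : Euc N) : Prop :=
  γ 0 = x ∧ HasDerivAt (fun t => (γ t : Euc N)) a 0

/-- The tangent space of `M` at `x`, spanned by the velocities of curves in `M` through `x`
(on a submanifold these already form a linear subspace, see `mem_tangentSpace_iff`). -/
def tangentSpace {N : ℕ} (M : Set (Euc N)) (x : M) : Submodule ℝ (Euc N) :=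
  Submodule.span ℝ {a | ∃ γ : ℝ → M, IsCurveWithVelocity γ x a}

lemma tangentSpace_aux {m N : ℕ} {M : Set (Euc N)} (hM : IsSmoothSubmanifold m M) (x : M) :
    ∃ S : Submodule ℝ (Euc N), finrank ℝ S = m ∧
      {a | ∃ γ : ℝ → M, IsCurveWithVelocity γ x a} = (S : Set (Euc N)) := by
  classical
  obtain ⟨Φ, L, hx, hL, h1, h2, h3⟩ := hM x x.2
  have hy : Φ x ∈ Φ.target := Φ.map_source hx
  have d1 : HasFDerivAt Φ (fderiv ℝ Φ x) x :=
    ((h1.contDiffAt (Φ.open_source.mem_nhds hx)).differentiableAt (by simp)).hasFDerivAt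
  have d2 : HasFDerivAt Φ.symm (fderiv ℝ Φ.symm (Φ x)) (Φ x) :=
    ((h2.contDiffAt (Φ.open_target.mem_nhds hy)).differentiableAt (by simp)).hasFDerivAt
  set A := fderiv ℝ Φ x
  set B := fderiv ℝ Φ.symm (Φ x)
  have d2' : HasFDerivAt Φ.symm B (Φ x) := d2
  have d1' : HasFDerivAt Φ A (Φ.symm (Φ x)) := by rw [Φ.left_inv hx]; exact d1
  have hBA : B.comp A = ContinuousLinearMap.id ℝ _ := by
    have e : Φ.symm ∘ Φ =ᶠ[𝓝 (x : Euc N)] id := by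
      filter_upwards [Φ.open_source.mem_nhds hx] with z hz using Φ.left_inv hz
    exact (d2'.comp _ d1).unique ((hasFDerivAt_id _).congr_of_eventuallyEq e)
  have hAB : A.comp B = ContinuousLinearMap.id ℝ _ := by
    have e : Φ ∘ Φ.symm =ᶠ[𝓝 (Φ x)] id := by
      filter_upwards [Φ.open_target.mem_nhds hy] with z hz using Φ.right_inv hz
    exact (d1'.comp _ d2').unique ((hasFDerivAt_id _).congr_of_eventuallyEq e)
  have hinj : Function.Injective (B : Euc N →ₗ[ℝ] Euc N) := by
    intro u v huv
    have := congrArg A huv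
    simpa [← ContinuousLinearMap.comp_apply, hAB] using this
  refine ⟨L.map (B : Euc N →ₗ[ℝ] Euc N), ?_, ?_⟩
  · rw [← hL]
    exact (Submodule.equivMapOfInjective _ hinj L).finrank_eq.symm
  · ext a
    simp only [mem_ofPred_eq, SetLike.mem_coe, Submodule.mem_map]
    constructor
    · rintro ⟨γ, h0, hγ⟩
      refine ⟨A a, ?_, by simpa using DFunLike.congr_fun hBA a⟩
      have hγ0 : HasFDerivAt Φ A ((fun t => (γ t : Euc N)) 0) := by simpa [h0] using d1
      have hd : HasDerivAt (fun t => Φ (γ t)) (A a) 0 := hγ0.comp_hasDerivAt 0 hγ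
      have hev : ∀ᶠ t in 𝓝 (0 : ℝ), (γ t : Euc N) ∈ Φ.source :=
        hγ.continuousAt.eventually (Φ.open_source.mem_nhds (by simpa [h0] using hx))
      have hmem : ∀ᶠ t in 𝓝[≠] (0 : ℝ), slope (fun t => Φ (γ t)) 0 t ∈ (L : Set (Euc N)) := by
        filter_upwards [hev.filter_mono nhdsWithin_le_nhds] with t ht
        rw [slope_def_module]
        exact L.smul_mem _ (L.sub_mem ((h3 _ ht).1 (γ t).2)
          ((h3 _ (by simpa [h0] using hx)).1 (γ 0).2))
      exact L.closed_of_finiteDimensional.mem_of_tendsto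
        (hasDerivAt_iff_tendsto_slope.1 hd) hmem
    · rintro ⟨l, hl, rfl⟩
      have hc : HasDerivAt (fun t : ℝ => Φ x + t • l) l 0 := by
        simpa using ((hasDerivAt_id (0 : ℝ)).smul_const l).const_add (Φ x)
      let c : ℝ → Euc N := fun t => Φ.symm (Φ x + t • l)
      have hx0 : Φ x ∈ L := (h3 _ hx).1 x.2
      have hev : ∀ᶠ t in 𝓝 (0 : ℝ), c t ∈ M := by
        have : ∀ᶠ t in 𝓝 (0 : ℝ), Φ x + t • l ∈ Φ.target :=
          hc.continuousAt.eventually (Φ.open_target.mem_nhds (by simpa using hy))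
        filter_upwards [this] with t ht
        rw [h3 _ (Φ.map_target ht), Φ.right_inv ht]
        exact L.add_mem hx0 (L.smul_mem _ hl)
      have hcd : HasDerivAt c (B l) 0 := by
        have : HasFDerivAt Φ.symm B ((fun t : ℝ => Φ x + t • l) 0) := by simpa using d2'
        exact this.comp_hasDerivAt 0 hc
      refine ⟨fun t => if h : c t ∈ M then ⟨c t, h⟩ else x, ?_, ?_⟩
      · have : c 0 = x := by simp [c, Φ.left_inv hx]
        simp [this]
      · refine hcd.congr_of_eventuallyEq ?_
        filter_upwards [hev] with t ht
        simp [ht]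

lemma mem_tangentSpace_iff {m N : ℕ} {M : Set (Euc N)} (hM : IsSmoothSubmanifold m M) (x : M)
    (a : Euc N) : a ∈ tangentSpace M x ↔ ∃ γ : ℝ → M, IsCurveWithVelocity γ x a := by
  obtain ⟨S, -, hS⟩ := tangentSpace_aux hM x
  rw [tangentSpace, hS, Submodule.span_eq, ← SetLike.mem_coe, ← hS, mem_ofPred_eq]

lemma finrank_tangentSpace {m N : ℕ} {M : Set (Euc N)} (hM : IsSmoothSubmanifold m M) (x : M) :
    finrank ℝ (tangentSpace M x) = m := by
  obtain ⟨S, hm, hS⟩ := tangentSpace_aux hM x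
  rw [tangentSpace, hS, Submodule.span_eq, hm]

/-- The orthogonal projection of `ℝ^N` onto the tangent space of `M` at `x`. -/
def tangentProj {N : ℕ} (M : Set (Euc N)) (x : M) : Euc N →L[ℝ] Euc N :=
  (tangentSpace M x).starProjection

/-- The orthogonal projection of `ℝ^N` onto the normal space of `M` at `x`. -/
def normalProj {N : ℕ} (M : Set (Euc N)) (x : M) : Euc N →L[ℝ] Euc N :=
  (tangentSpace M x)ᗮ.starProjection

/-- Orthonormal frame `τ₁, …, τ_d` of the tangent space at `x`, where `d` is its dimension. -/
def frame {N : ℕ} (M : Set (Euc N)) (x : M) :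
    OrthonormalBasis (Fin (finrank ℝ (tangentSpace M x))) ℝ (tangentSpace M x) :=
  stdOrthonormalBasis ℝ (tangentSpace M x)

/-! ### Directional derivative, vector derivative, monogenic functions -/

/-- `D` is the directional derivative `(a · ∂)F` at `x` of a function `F` on `M`:
`(F(γ(t)) - F(γ(0))) / t → D` as `t → 0` for the curves `γ` in `M` with `γ(0) = x` and
`γ'(0) = a`. -/
def HasDirDeriv {N : ℕ} {M : Set (Euc N)} {W : Type*} [AddCommGroup W] [Module ℝ W]
    [TopologicalSpace W] (F : M → W) (x : M) (a : Euc N) (D : W) : Prop :=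
  ∀ γ : ℝ → M, IsCurveWithVelocity γ x a →
    Tendsto (fun t : ℝ => t⁻¹ • (F (γ t) - F (γ 0))) (𝓝[≠] 0) (𝓝 D)

/-- All directional derivatives of `F` in tangent directions exist. -/
def DirDifferentiable {N : ℕ} {M : Set (Euc N)} {W : Type*} [AddCommGroup W] [Module ℝ W]
    [TopologicalSpace W] (F : M → W) : Prop :=
  ∀ x : M, ∀ a ∈ tangentSpace M x, ∃ D, HasDirDeriv F x a D

open Classical in
/-- The directional derivative `(a · ∂)F` at `x` (with value `0` where it does not exist). -/
def dirDeriv {N : ℕ} {M : Set (Euc N)} {W : Type*} [AddCommGroup W] [Module ℝ W]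
    [TopologicalSpace W] (F : M → W) (x : M) (a : Euc N) : W :=
  if h : ∃ D, HasDirDeriv F x a D then h.choose else 0

/-- The (left) vector derivative `∂F = ∑ⱼ τⱼ (τⱼ · ∂)F`, with the geometric product. -/
def vectorDeriv {N : ℕ} {M : Set (Euc N)} (F : M → Multivector N) (x : M) : Multivector N :=
  ∑ j, vec (frame M x j : Euc N) * dirDeriv F x (frame M x j)

/-- The right vector derivative `F∂ = ∑ⱼ ((τⱼ · ∂)F) τⱼ`, with the geometric product. -/
def rightVectorDeriv {N : ℕ} {M : Set (Euc N)} (F : M → Multivector N) (x : M) :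
    Multivector N :=
  ∑ j, dirDeriv F x (frame M x j) * vec (frame M x j : Euc N)

/-- `F` is left monogenic: its directional derivatives exist and `∂F ≡ 0` on `M`. -/
def IsLeftMonogenic {N : ℕ} {M : Set (Euc N)} (F : M → Multivector N) : Prop :=
  DirDifferentiable F ∧ ∀ x, vectorDeriv F x = 0

/-- `F` is monogenic: its directional derivatives exist, `∂F ≡ 0` and `F∂ ≡ 0` on `M`. -/
def IsMonogenic {N : ℕ} {M : Set (Euc N)} (F : M → Multivector N) : Prop :=
  DirDifferentiable F ∧ ∀ x, vectorDeriv F x = 0 ∧ rightVectorDeriv F x = 0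

/-! ### Mean curvature -/

/-- The second fundamental form `II(a, b) = ((a · ∂)b)^⊥` at `x`: the normal part of the
directional derivative of a tangent vector field with value `b` at `x`. The tangent vector `b` is
extended to the tangent field `y ↦ P_y b`, with `P_y` the projection onto the tangent space at
`y`; the normal part does not depend on the extension. -/
def secondFundamentalForm {N : ℕ} (M : Set (Euc N)) (x : M) (a b : Euc N) : Euc N :=
  normalProj M x (dirDeriv (fun y : M => tangentProj M y b) x a)

/-- The mean curvature vector: the trace of the second fundamental form
(not divided by the dimension). -/
def meanCurvature {N : ℕ} (M : Set (Euc N)) (x : M) : Euc N :=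
  ∑ j, secondFundamentalForm M x (frame M x j) (frame M x j)

/-- `M` is minimal: its mean curvature vector vanishes identically. -/
def IsMinimal {N : ℕ} (M : Set (Euc N)) : Prop :=
  ∀ x : M, meanCurvature M x = 0

/-! ### Orientation and Gauss map -/

/-- `o` is an orientation of the submanifold `M`: a choice of an orientation of each tangent space
that varies continuously, i.e. near each point it is that of a continuous frame of tangent spaces,
or the opposite one everywhere there (the latter matters only for `m = 0`, where the two
orientations of a point are the two signs). -/
def IsOrientation {m N : ℕ} (M : Set (Euc N))
    (o : ∀ x : M, Orientation ℝ (tangentSpace M x) (Fin m)) : Prop :=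
  ∀ x : M, ∃ U ∈ 𝓝 x, ∃ b : ∀ y : M, Basis (Fin m) ℝ (tangentSpace M y),
    (∀ i, ContinuousOn (fun y : M => (b y i : Euc N)) U) ∧
    ((∀ y ∈ U, o y = (b y).orientation) ∨ (∀ y ∈ U, o y = -(b y).orientation))

open Classical in
/-- The Gauss map of the oriented submanifold `M`: the unit tangent `m`-blade
`τ₁ ∧ … ∧ τₘ` for a positively oriented orthonormal frame `τ` of the tangent space at `x`. It is
written with an arbitrary orthonormal frame, with a minus sign if that frame is negatively
oriented; see `gaussMap_eq_wedge`. -/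
def gaussMap {m N : ℕ} {M : Set (Euc N)} (hM : IsSmoothSubmanifold m M)
    (o : ∀ x : M, Orientation ℝ (tangentSpace M x) (Fin m)) (x : M) : Multivector N :=
  let τ : OrthonormalBasis (Fin m) ℝ (tangentSpace M x) :=
    (frame M x).reindex (finCongr (finrank_tangentSpace hM x))
  if τ.toBasis.orientation = o x then wedge (fun j => (τ j : Euc N))
  else -wedge (fun j => (τ j : Euc N))

/-- The exterior product of the ambient vectors, as an alternating map on a subspace. -/
def wedgeAlt (m : ℕ) {N : ℕ} (V : Submodule ℝ (Euc N)) : V [⋀^Fin m]→ₗ[ℝ] Multivector N :=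
  letI : Invertible (2 : ℝ) := invertibleOfNonzero two_ne_zero
  ((CliffordAlgebra.equivExterior (normSqForm N)).symm.toLinearMap.compAlternatingMap
    (ExteriorAlgebra.ιMulti ℝ m)).compLinearMap V.subtype

lemma wedgeAlt_apply {m N : ℕ} (V : Submodule ℝ (Euc N)) (v : Fin m → V) :
    wedgeAlt m V v = wedge (fun j => (v j : Euc N)) := rfl

/-- The Gauss map is `τ₁ ∧ … ∧ τₘ` for every positively oriented orthonormal frame. -/
lemma gaussMap_eq_wedge {m N : ℕ} {M : Set (Euc N)} (hM : IsSmoothSubmanifold m M)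
    (o : ∀ x : M, Orientation ℝ (tangentSpace M x) (Fin m)) (x : M)
    (τ : OrthonormalBasis (Fin m) ℝ (tangentSpace M x)) (hτ : τ.toBasis.orientation = o x) :
    gaussMap hM o x = wedge (fun j => (τ j : Euc N)) := by
  classical
  set σ : OrthonormalBasis (Fin m) ℝ (tangentSpace M x) :=
    (frame M x).reindex (finCongr (finrank_tangentSpace hM x)) with hσ
  have key : wedge (fun j => (τ j : Euc N)) =
      σ.toBasis.det τ • wedge (fun j => (σ j : Euc N)) := by
    have h : wedgeAlt m (tangentSpace M x) =
        (LinearMap.toSpanSingleton ℝ _ (wedgeAlt m (tangentSpace M x) σ)).compAlternatingMap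
          σ.toBasis.det := by
      refine Basis.ext_alternating σ.toBasis fun v hv => ?_
      obtain ⟨e, rfl⟩ : ∃ e : Equiv.Perm (Fin m), v = e :=
        ⟨Equiv.ofBijective v (Finite.injective_iff_bijective.1 hv), rfl⟩
      have hd : σ.toBasis.det (fun i => σ.toBasis (e i)) = (Equiv.Perm.sign e : ℤ) := by
        have := AlternatingMap.map_perm σ.toBasis.det σ.toBasis e
        rw [Basis.det_self] at this
        simpa [Function.comp_def, Units.smul_def] using this
      have hw := AlternatingMap.map_perm (wedgeAlt m (tangentSpace M x)) σ e
      simp only [LinearMap.compAlternatingMap_apply, LinearMap.toSpanSingleton_apply, hd]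
      simp only [Function.comp_def] at hw
      simp only [OrthonormalBasis.coe_toBasis, hw]
      rcases Int.units_eq_one_or (Equiv.Perm.sign e) with h1 | h1 <;> simp [h1]
    have := DFunLike.congr_fun h (fun j => τ j)
    simpa [wedgeAlt_apply] using this
  rw [gaussMap, ← hσ]
  split_ifs with hc
  · have : σ.toBasis.det τ = 1 :=
      (OrthonormalBasis.det_to_matrix_orthonormalBasis_of_same_orientation σ τ (hc.trans hτ.symm))
    rw [key, this, one_smul]
  · have : σ.toBasis.det τ = -1 :=
      (OrthonormalBasis.det_to_matrix_orthonormalBasis_of_opposite_orientation σ τ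
        (fun h => hc (h.trans hτ)))
    rw [key, this, neg_one_smul]

end

end GeometricCalculus

/-!
For `x ∈ M` let `P` be the orthogonal projection onto the tangent space, `τ` an orthonormal frame
at `x`, `G` the Gauss map and `H` the mean curvature vector. The theorem follows from the formulas
`∂G = -H G` and `G∂ = (-1)^(m+1) H G` (`vectorDeriv_gaussMap`), since `G` is, up to sign, a product
of unit vectors and hence invertible in the geometric algebra (`isUnit_wedge`).

*The second fundamental form.* In a chart `Φ` straightening `M` to a linear subspace `L`, the
operator `E = D(Φ⁻¹) ∘ π_L ∘ DΦ` is an idempotent onto the tangent space, so that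
`P = E (1 + E - E*)⁻¹` depends smoothly on the point. Differentiating `P P = P` shows that
`II(a, b) = (∂ₐP) b` is normal for tangent `a`, `b`; differentiating `P Y = Y` for the tangent
fields `Y` that are constant in the chart expresses it by the second derivative of `Φ⁻¹`, whence
it is symmetric (`exists_deriv_tangentProj`).

*The derivative of the Gauss map.* Near `x`, continuity of the orientation gives
`G = ± (Pτ₁ ∧ … ∧ Pτₘ) / |Pτ₁ ∧ … ∧ Pτₘ|` with a constant sign, and the squared norm is the Gram
determinant of the `⟨τᵢ, Pτⱼ⟩` (`eventually_gaussMap_eq`). The derivative of the latter at `x` vanishes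
because `⟨τᵢ, II(a, τⱼ)⟩ = 0`, so `∂ₐG` is the sum over `j` of `± τ₁ ∧ … ∧ II(a, τⱼ) ∧ … ∧ τₘ`
(`hasDirDeriv_gaussMap`), and the `j`-th summand equals `II(a, τⱼ) τⱼ G` (`wedge_update`).

*Conclusion.* `∂G = ∑ τₖ II(τₖ, τⱼ) τⱼ G = -∑ II(τₖ, τⱼ) τₖ τⱼ G`. As `II` is symmetric and
`τₖ τⱼ + τⱼ τₖ = 2 δₖⱼ`, only the trace of `II` survives (`sum_sum_mul_vec_mul_vec`). The right
derivative is treated in the same way after moving `τₖ` through `G` (`wedge_mul_vec`).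
-/

namespace GeometricCalculus

noncomputable section

/-! ### Blades in the geometric algebra -/

lemma vec_mul_self {N : ℕ} (a : Euc N) :
    vec a * vec a = algebraMap ℝ (Multivector N) (inner ℝ a a) := by
  exact CliffordAlgebra.ι_sq_scalar _ _

lemma vec_mul_vec_add_swap {N : ℕ} (a b : Euc N) :
    vec a * vec b + vec b * vec a = algebraMap ℝ (Multivector N) (2 * inner ℝ a b) := by
  rw [vec, vec, CliffordAlgebra.ι_mul_ι_add_swap]
  congr 1
  simp only [QuadraticMap.polar, normSqForm, LinearMap.BilinMap.toQuadraticMap_apply,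
    innerₗ_apply_apply, inner_add_left, inner_add_right, real_inner_comm b a]
  ring

lemma vec_mul_vec_of_inner_eq_zero {N : ℕ} {a b : Euc N} (h : inner ℝ a b = 0) :
    vec a * vec b = -(vec b * vec a) := by
  have := vec_mul_vec_add_swap a b
  rw [h, mul_zero, map_zero] at this
  exact eq_neg_of_add_eq_zero_left this

lemma vec_mul_self_of_norm_one {N : ℕ} {a : Euc N} (h : inner ℝ a a = 1) :
    vec a * vec a = 1 := by
  rw [vec_mul_self, h, map_one]

/-- The exterior product of vectors, as an alternating map. -/
def wedgeMap (m N : ℕ) : Euc N [⋀^Fin m]→ₗ[ℝ] Multivector N :=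
  letI : Invertible (2 : ℝ) := invertibleOfNonzero two_ne_zero
  (CliffordAlgebra.equivExterior (normSqForm N)).symm.toLinearMap.compAlternatingMap
    (ExteriorAlgebra.ιMulti ℝ m)

lemma wedgeMap_apply {m N : ℕ} (v : Fin m → Euc N) : wedgeMap m N v = wedge v := rfl

lemma contractLeft_ιMulti_eq_zero {E : Type*} [AddCommGroup E] [Module ℝ E] (d : Module.Dual ℝ E) :
    ∀ {m : ℕ} (v : Fin m → E), (∀ i, d (v i) = 0) →
      CliffordAlgebra.contractLeft (Q := (0 : QuadraticForm ℝ E)) d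
        (ExteriorAlgebra.ιMulti ℝ m v) = 0
  | 0, v, _ => by
    rw [ExteriorAlgebra.ιMulti_zero_apply]
    exact CliffordAlgebra.contractLeft_one (Q := (0 : QuadraticForm ℝ E)) d
  | m + 1, v, h => by
    rw [ExteriorAlgebra.ιMulti_succ_apply]
    refine (CliffordAlgebra.contractLeft_ι_mul (Q := (0 : QuadraticForm ℝ E)) d _ _).trans ?_
    rw [contractLeft_ιMulti_eq_zero d (Matrix.vecTail v) fun i => h i.succ, h 0]
    simp

lemma wedge_zero {N : ℕ} (v : Fin 0 → Euc N) : wedge v = 1 := by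
  let : Invertible (2 : ℝ) := invertibleOfNonzero two_ne_zero
  rw [wedge, ExteriorAlgebra.ιMulti_zero_apply]
  exact CliffordAlgebra.changeForm_one
    (CliffordAlgebra.changeForm.neg_proof CliffordAlgebra.changeForm.associated_neg_proof)

/-- A vector orthogonal to all factors of an exterior product multiplies it geometrically as it
does exteriorly, because its contraction with the product vanishes. -/
lemma wedge_cons {m N : ℕ} (a : Euc N) (v : Fin m → Euc N) (h : ∀ i, inner ℝ a (v i) = 0) :
    wedge (Fin.cons a v : Fin (m + 1) → Euc N) = vec a * wedge v := by
  let : Invertible (2 : ℝ) := invertibleOfNonzero two_ne_zero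
  have ht : Matrix.vecTail (Fin.cons a v : Fin (m + 1) → Euc N) = v := by
    ext i; simp [Matrix.vecTail]
  rw [wedge, ExteriorAlgebra.ιMulti_succ_apply, ht, Fin.cons_zero]
  refine (CliffordAlgebra.changeForm_ι_mul
    (CliffordAlgebra.changeForm.neg_proof CliffordAlgebra.changeForm.associated_neg_proof)
    a (ExteriorAlgebra.ιMulti ℝ m v)).trans ?_
  rw [← CliffordAlgebra.changeForm_contractLeft, contractLeft_ιMulti_eq_zero, map_zero, sub_zero]
  · rfl
  · intro i
    have h' := h i
    have h'' : inner ℝ (v i) a = 0 := by rw [real_inner_comm]; exact h'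
    simp [QuadraticMap.associated_apply, normSqForm, inner_add_right, h', h'']

/-- Replacing the factor `vⱼ` of an orthonormal blade by a vector `n` orthogonal to all factors
amounts to multiplying by `n vⱼ` from the left. -/
lemma wedge_update {N : ℕ} (n : Euc N) : ∀ {m : ℕ} (v : Fin m → Euc N), Orthonormal ℝ v →
    (∀ i, inner ℝ n (v i) = 0) → ∀ j,
      wedge (Function.update v j n) = vec n * vec (v j) * wedge v
  | 0, _, _, _, j => j.elim0
  | m + 1, v, hv, hn, j => by
    induction v using Fin.consCases with
    | _ a w =>
    have hw : Orthonormal ℝ w := by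
      simpa [Function.comp_def] using hv.comp Fin.succ (Fin.succ_injective m)
    have haw : ∀ i, inner ℝ a (w i) = 0 := fun i => by
      simpa using hv.2 (Fin.succ_ne_zero i).symm
    have haa : vec a * vec a = 1 := vec_mul_self_of_norm_one (by
      have := hv.1 0
      simp only [Fin.cons_zero] at this
      simp [this])
    have hna : inner ℝ n a = 0 := hn 0
    have hnw : ∀ i, inner ℝ n (w i) = 0 := fun i => hn i.succ
    rw [wedge_cons a w haw]
    induction j using Fin.cases with
    | zero =>
      rw [Fin.update_cons_zero, wedge_cons n w hnw, Fin.cons_zero, mul_assoc (vec n),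
        ← mul_assoc (vec a), haa, one_mul]
    | succ j =>
      rw [← Fin.cons_update, wedge_cons, wedge_update n w hw hnw j, Fin.cons_succ]
      · have h1 := vec_mul_vec_of_inner_eq_zero hna
        have h2 := vec_mul_vec_of_inner_eq_zero (haw j)
        calc vec a * (vec n * vec (w j) * wedge w)
            = (vec a * vec n) * vec (w j) * wedge w := by noncomm_ring
          _ = vec n * vec (w j) * (vec a * wedge w) := by
            rw [eq_neg_iff_add_eq_zero] at h1
            rw [eq_neg_of_add_eq_zero_right h1]
            have : -(vec n * vec a) * vec (w j) * wedge w
              = -(vec n * (vec a * vec (w j)) * wedge w) := by noncomm_ring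
            rw [this, h2]
            noncomm_ring
      · intro i
        by_cases hij : i = j
        · subst hij
          rw [Function.update_self, real_inner_comm, hna]
        · rw [Function.update_of_ne hij, haw]

lemma wedge_mul_vec_of_orthogonal {N : ℕ} (a : Euc N) : ∀ {m : ℕ} (v : Fin m → Euc N),
    Orthonormal ℝ v → (∀ i, inner ℝ a (v i) = 0) →
      wedge v * vec a = (-1 : ℝ) ^ m • (vec a * wedge v)
  | 0, v, _, _ => by simp [wedge_zero]
  | m + 1, v, hv, ha => by
    induction v using Fin.consCases with
    | _ b w =>
    have hw : Orthonormal ℝ w := by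
      simpa [Function.comp_def] using hv.comp Fin.succ (Fin.succ_injective m)
    have hbw : ∀ i, inner ℝ b (w i) = 0 := fun i => by
      simpa using hv.2 (Fin.succ_ne_zero i).symm
    have hab : inner ℝ a b = 0 := ha 0
    rw [wedge_cons b w hbw, mul_assoc, wedge_mul_vec_of_orthogonal a w hw fun i => ha i.succ,
      mul_smul_comm, ← mul_assoc, ← mul_assoc, vec_mul_vec_of_inner_eq_zero hab, pow_succ]
    simp

/-- A factor of an orthonormal blade commutes with it up to a sign. -/
lemma wedge_mul_vec {N : ℕ} : ∀ {m : ℕ} (v : Fin m → Euc N), Orthonormal ℝ v → ∀ k,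
    wedge v * vec (v k) = (-1 : ℝ) ^ (m + 1) • (vec (v k) * wedge v)
  | 0, _, _, k => k.elim0
  | m + 1, v, hv, k => by
    induction v using Fin.consCases with
    | _ a w =>
    have hw : Orthonormal ℝ w := by
      simpa [Function.comp_def] using hv.comp Fin.succ (Fin.succ_injective m)
    have haw : ∀ i, inner ℝ a (w i) = 0 := fun i => by
      simpa using hv.2 (Fin.succ_ne_zero i).symm
    rw [wedge_cons a w haw, mul_assoc]
    induction k using Fin.cases with
    | zero =>
      rw [Fin.cons_zero, wedge_mul_vec_of_orthogonal a w hw haw, mul_smul_comm, pow_succ, pow_succ]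
      simp
    | succ k =>
      rw [Fin.cons_succ, wedge_mul_vec w hw k, mul_smul_comm, ← mul_assoc, ← mul_assoc,
        vec_mul_vec_of_inner_eq_zero (haw k), pow_succ _ (m + 1)]
      simp

lemma isUnit_wedge {N : ℕ} : ∀ {m : ℕ} (v : Fin m → Euc N), Orthonormal ℝ v →
    IsUnit (wedge v)
  | 0, v, _ => by simp [wedge_zero]
  | m + 1, v, hv => by
    induction v using Fin.consCases with
    | _ a w =>
    have hw : Orthonormal ℝ w := by
      simpa [Function.comp_def] using hv.comp Fin.succ (Fin.succ_injective m)
    have haa : vec a * vec a = 1 := vec_mul_self_of_norm_one (by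
      have := hv.1 0
      simp only [Fin.cons_zero] at this
      simp [this])
    rw [wedge_cons a w fun i => by simpa using hv.2 (Fin.succ_ne_zero i).symm]
    exact IsUnit.mul ⟨⟨vec a, vec a, haa, haa⟩, rfl⟩ (isUnit_wedge w hw)

lemma vec_eq_zero_iff {N : ℕ} {a : Euc N} : vec a = 0 ↔ a = 0 := by
  let : Invertible (2 : ℝ) := invertibleOfNonzero two_ne_zero
  refine ⟨fun h => ?_, fun h => by simp [h, vec]⟩
  have h1 := vec_mul_self a
  rw [h, mul_zero] at h1
  exact inner_self_eq_zero.1 ((FaithfulSMul.algebraMap_injective ℝ (Multivector N))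
    (h1.symm.trans (map_zero _).symm))

lemma vec_sum {N : ℕ} {ι : Type*} (s : Finset ι) (f : ι → Euc N) :
    vec (∑ i ∈ s, f i) = ∑ i ∈ s, vec (f i) := map_sum _ _ _

/-- In a double sum weighted by symmetric coefficients `n j k`, the products of distinct
orthonormal vectors cancel, and only the trace of `n` remains. -/
lemma sum_sum_mul_vec_mul_vec {m N : ℕ} (v : Fin m → Euc N) (hv : Orthonormal ℝ v)
    (n : Fin m → Fin m → Euc N) (hn : ∀ j k, n j k = n k j) :
    ∑ k, ∑ j, vec (n k j) * vec (v j) * vec (v k) = vec (∑ k, n k k) := by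
  have h1 : ∑ k, ∑ j, vec (n k j) * vec (v j) * vec (v k)
      = ∑ k, ∑ j, vec (n k j) * vec (v k) * vec (v j) := by
    rw [Finset.sum_comm]
    exact Finset.sum_congr rfl fun j _ => Finset.sum_congr rfl fun k _ => by rw [hn]
  have h2 : (2 : ℝ) • ∑ k, ∑ j, vec (n k j) * vec (v j) * vec (v k)
      = (2 : ℝ) • vec (∑ k, n k k) := by
    rw [two_smul]
    nth_rewrite 2 [h1]
    simp_rw [← Finset.sum_add_distrib, mul_assoc, ← mul_add, vec_mul_vec_add_swap,
      orthonormal_iff_ite.1 hv, vec_sum, Finset.smul_sum]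
    refine Finset.sum_congr rfl fun k _ => ?_
    rw [Finset.sum_eq_single k]
    · rw [← Algebra.commutes, ← Algebra.smul_def]
      simp
    · intro j _ hj
      simp [hj]
    · simp
  exact smul_right_injective _ (two_ne_zero (α := ℝ)) h2

/-! ### Directional derivatives -/

/-- Multivectors are separated by linear functionals, which are continuous for the module
topology. -/
instance (N : ℕ) : T2Space (Multivector N) := by
  refine T2Space.of_injective_continuous (Y := Module.Dual ℝ (Multivector N) → ℝ)
    (f := fun x φ => φ x) ?_ ?_
  · intro x y h
    rw [← sub_eq_zero, ← Module.forall_dual_apply_eq_zero_iff ℝ]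
    intro φ
    rw [map_sub, sub_eq_zero]
    exact congrFun h φ
  · exact continuous_pi fun φ => IsModuleTopology.continuous_of_linearMap φ

lemma HasDirDeriv.dirDeriv_eq {m N : ℕ} {M : Set (Euc N)} (hM : IsSmoothSubmanifold m M)
    {W : Type*} [AddCommGroup W] [Module ℝ W] [TopologicalSpace W] [T2Space W] {F : M → W} {x : M}
    {a : Euc N} {D : W} (ha : a ∈ tangentSpace M x) (h : HasDirDeriv F x a D) :
    dirDeriv F x a = D := by
  have hex : ∃ D, HasDirDeriv F x a D := ⟨D, h⟩
  obtain ⟨γ, hγ⟩ := (mem_tangentSpace_iff hM x a).1 ha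
  rw [dirDeriv, dif_pos hex]
  exact tendsto_nhds_unique (hex.choose_spec γ hγ) (h γ hγ)

/-- A curve in `M` with a velocity is continuous at time `0`. -/
lemma IsCurveWithVelocity.tendsto {N : ℕ} {M : Set (Euc N)} {γ : ℝ → M} {x : M} {a : Euc N}
    (h : IsCurveWithVelocity γ x a) : Tendsto γ (𝓝 0) (𝓝 x) := by
  rw [tendsto_subtype_rng]
  have := h.2.continuousAt.tendsto
  rwa [h.1] at this

/-- The Leibniz rule for a multilinear map with values in a topological vector space that need
not be normed, such as the space of multivectors. -/
lemma tendsto_slope_multilinearMap {m N : ℕ} {W : Type*} [AddCommGroup W] [Module ℝ W]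
    [TopologicalSpace W] [ContinuousAdd W] [ContinuousSMul ℝ W]
    (f : MultilinearMap ℝ (fun _ : Fin m => Euc N) W) {v : ℝ → Fin m → Euc N}
    {v' : Fin m → Euc N} (h : ∀ j, HasDerivAt (fun t => v t j) (v' j) 0) :
    Tendsto (fun t : ℝ => t⁻¹ • (f (v t) - f (v 0))) (𝓝[≠] 0)
      (𝓝 (∑ j, f (Function.update (v 0) j (v' j)))) := by
  -- in coordinates, `f` is a finite sum of fixed elements of `W` with scalar coefficients
  have hf : ∀ u : Fin m → Euc N, f u = ∑ r : Fin m → Fin N,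
      (∏ i, u i (r i)) • f fun i => EuclideanSpace.basisFun (Fin N) ℝ (r i) := by
    intro u
    have hu : u = fun i => ∑ k, u i k • EuclideanSpace.basisFun (Fin N) ℝ k := by
      ext1 i
      simpa using ((EuclideanSpace.basisFun (Fin N) ℝ).sum_repr (u i)).symm
    conv_lhs => rw [hu]
    rw [MultilinearMap.map_sum]
    exact Finset.sum_congr rfl fun r _ => f.map_smul_univ _ _
  have hd : ∀ r : Fin m → Fin N, HasDerivAt (fun t => ∏ i, v t i (r i))
      (∑ j, ∏ i, Function.update (v 0) j (v' j) i (r i)) 0 := by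
    intro r
    have hc : ∀ i ∈ Finset.univ, HasDerivAt (fun t => v t i (r i)) (v' i (r i)) 0 := fun i _ =>
      ((EuclideanSpace.proj (r i) : Euc N →L[ℝ] ℝ).hasFDerivAt).comp_hasDerivAt 0 (h i)
    refine (HasDerivAt.fun_finsetProd hc).congr_deriv ?_
    refine Finset.sum_congr rfl fun j _ => ?_
    rw [← Finset.mul_prod_erase _ _ (Finset.mem_univ j), Function.update_self, smul_eq_mul,
      mul_comm]
    congr 1
    refine Finset.prod_congr rfl fun i hi => ?_
    rw [Function.update_of_ne (Finset.ne_of_mem_erase hi)]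
  have key : Tendsto (fun t : ℝ => ∑ r : Fin m → Fin N,
      (t⁻¹ • ((∏ i, v t i (r i)) - ∏ i, v 0 i (r i))) •
        f fun i => EuclideanSpace.basisFun (Fin N) ℝ (r i)) (𝓝[≠] 0)
      (𝓝 (∑ r : Fin m → Fin N, (∑ j, ∏ i, Function.update (v 0) j (v' j) i (r i)) •
        f fun i => EuclideanSpace.basisFun (Fin N) ℝ (r i))) := by
    refine tendsto_finsetSum _ fun r _ => ?_
    have := (hasDerivAt_iff_tendsto_slope_zero.1 (hd r))
    simp only [zero_add] at this
    exact this.smul_const _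
  have e : ∑ j, f (Function.update (v 0) j (v' j)) =
      ∑ r : Fin m → Fin N, (∑ j, ∏ i, Function.update (v 0) j (v' j) i (r i)) •
        f fun i => EuclideanSpace.basisFun (Fin N) ℝ (r i) := by
    simp_rw [hf (Function.update _ _ _), Finset.sum_smul]
    exact Finset.sum_comm
  rw [e]
  refine key.congr fun t => ?_
  rw [hf (v t), hf (v 0), ← Finset.sum_sub_distrib, Finset.smul_sum]
  refine Finset.sum_congr rfl fun r _ => ?_
  rw [← sub_smul, smul_assoc]

/-! ### The tangent projection along the submanifold -/

/-- In a chart `Φ` straightening `M` to `L`, the tangent spaces of `M` are the images of `L` under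
the derivative of `Φ⁻¹`. -/
lemma chart_tangentSpace {m N : ℕ} {M : Set (Euc N)} (hM : IsSmoothSubmanifold m M)
    {Φ : OpenPartialHomeomorph (Euc N) (Euc N)} {L : Submodule ℝ (Euc N)} (hL : finrank ℝ L = m)
    (h1 : ContDiffOn ℝ ∞ Φ Φ.source) (h2 : ContDiffOn ℝ ∞ Φ.symm Φ.target)
    (h3 : ∀ y ∈ Φ.source, y ∈ M ↔ Φ y ∈ L) (x : M) (hx : (x : Euc N) ∈ Φ.source) :
    (fderiv ℝ Φ.symm (Φ x)).comp (fderiv ℝ Φ x) = ContinuousLinearMap.id ℝ _ ∧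
    (∀ a ∈ tangentSpace M x, fderiv ℝ Φ x a ∈ L) ∧
    ∀ l ∈ L, fderiv ℝ Φ.symm (Φ x) l ∈ tangentSpace M x := by
  have hy : Φ x ∈ Φ.target := Φ.map_source hx
  have d1 : HasFDerivAt Φ (fderiv ℝ Φ x) x :=
    ((h1.contDiffAt (Φ.open_source.mem_nhds hx)).differentiableAt (by simp)).hasFDerivAt
  have d2 : HasFDerivAt Φ.symm (fderiv ℝ Φ.symm (Φ x)) (Φ x) :=
    ((h2.contDiffAt (Φ.open_target.mem_nhds hy)).differentiableAt (by simp)).hasFDerivAt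
  have hBA : (fderiv ℝ Φ.symm (Φ x)).comp (fderiv ℝ Φ x) = ContinuousLinearMap.id ℝ _ := by
    have e : Φ.symm ∘ Φ =ᶠ[𝓝 (x : Euc N)] id := by
      filter_upwards [Φ.open_source.mem_nhds hx] with z hz using Φ.left_inv hz
    exact (d2.comp _ d1).unique ((hasFDerivAt_id _).congr_of_eventuallyEq e)
  have hinj : Function.Injective (fderiv ℝ Φ x) := fun u v huv => by
    simpa [← ContinuousLinearMap.comp_apply, hBA] using congrArg (fderiv ℝ Φ.symm (Φ x)) huv
  have hmem : ∀ a ∈ tangentSpace M x, fderiv ℝ Φ x a ∈ L := by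
    intro a ha
    obtain ⟨γ, h0, hγ⟩ := (mem_tangentSpace_iff hM x a).1 ha
    have hγ0 : HasFDerivAt Φ (fderiv ℝ Φ x) ((fun t => (γ t : Euc N)) 0) := by
      simpa [h0] using d1
    have hd : HasDerivAt (fun t => Φ (γ t)) (fderiv ℝ Φ x a) 0 := hγ0.comp_hasDerivAt 0 hγ
    have hev : ∀ᶠ t in 𝓝 (0 : ℝ), (γ t : Euc N) ∈ Φ.source :=
      hγ.continuousAt.eventually (Φ.open_source.mem_nhds (by simpa [h0] using hx))
    have hs : ∀ᶠ t in 𝓝[≠] (0 : ℝ), slope (fun t => Φ (γ t)) 0 t ∈ (L : Set (Euc N)) := by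
      filter_upwards [hev.filter_mono nhdsWithin_le_nhds] with t ht
      rw [slope_def_module]
      exact L.smul_mem _ (L.sub_mem ((h3 _ ht).1 (γ t).2)
        ((h3 _ (by simpa [h0] using hx)).1 (γ 0).2))
    exact L.closed_of_finiteDimensional.mem_of_tendsto (hasDerivAt_iff_tendsto_slope.1 hd) hs
  refine ⟨hBA, hmem, fun l hl => ?_⟩
  -- the image of the tangent space lies in `L` and has the same dimension
  have hmap : (tangentSpace M x).map (fderiv ℝ Φ x : Euc N →ₗ[ℝ] Euc N) = L := by
    refine Submodule.eq_of_le_of_finrank_eq ?_ ?_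
    · rintro _ ⟨a, ha, rfl⟩
      exact hmem a ha
    · rw [hL, ← finrank_tangentSpace hM x]
      exact (Submodule.equivMapOfInjective _ hinj _).finrank_eq.symm
  rw [← hmap] at hl
  obtain ⟨a, ha, rfl⟩ := hl
  have : fderiv ℝ Φ.symm (Φ x) (fderiv ℝ Φ x a) = a := DFunLike.congr_fun hBA a
  simpa [this] using ha

/-- Since `E - E*` is skew-adjoint, `1 + E - E*` is invertible. -/
lemma isUnit_one_add_sub_star {N : ℕ} (E : Euc N →L[ℝ] Euc N) : IsUnit (1 + E - star E) := by
  have hinj : Function.Injective (1 + E - star E : Euc N →L[ℝ] Euc N) := by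
    rw [injective_iff_map_eq_zero]
    intro u hu
    have h := congrArg (inner ℝ u) hu
    simp only [sub_apply, add_apply,
      one_apply_eq_self, inner_sub_right, inner_add_right, inner_zero_right,
      ContinuousLinearMap.star_eq_adjoint, ContinuousLinearMap.adjoint_inner_right,
      real_inner_comm u (E u)] at h
    rw [← inner_self_eq_zero (𝕜 := ℝ)]
    linarith [real_inner_comm u (E u)]
  rw [ContinuousLinearMap.isUnit_iff_bijective]
  exact ⟨hinj, LinearMap.injective_iff_surjective
    (f := (1 + E - star E : Euc N →L[ℝ] Euc N).toLinearMap).1 hinj⟩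

/-- The orthogonal projection onto the range `T` of an idempotent `E` is `E (1 + E - E*)⁻¹`. -/
lemma starProjection_eq_mul_inverse {N : ℕ} (T : Submodule ℝ (Euc N)) (E : Euc N →L[ℝ] Euc N)
    (h1 : ∀ b, E b ∈ T) (h2 : ∀ a ∈ T, E a = a) :
    T.starProjection = E * Ring.inverse (1 + E - star E) := by
  have hPE : T.starProjection * E = E := by
    ext1 b
    exact T.starProjection_eq_self_iff.2 (h1 b)
  have hEP : E * T.starProjection = T.starProjection := by
    ext1 b
    exact h2 _ (T.starProjection_apply_mem b)
  have hPs : star T.starProjection = T.starProjection := (isSelfAdjoint_starProjection T)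
  have hPE' : T.starProjection * star E = T.starProjection := by
    have := congrArg star hEP
    rwa [star_mul, hPs] at this
  have : T.starProjection * (1 + E - star E) = E := by
    rw [mul_sub, mul_add, mul_one, hPE, hPE']
    abel
  calc T.starProjection
      = T.starProjection * (1 + E - star E) * Ring.inverse (1 + E - star E) := by
        rw [mul_assoc, Ring.mul_inverse_cancel _ (isUnit_one_add_sub_star E), mul_one]
    _ = E * Ring.inverse (1 + E - star E) := by rw [this]

/-- Derivative of the tangent projection: along curves in `M`, the projection `P` onto the tangent
space is differentiable, its derivative depends only on the velocity, and on tangent vectors it is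
normal-valued and symmetric, namely the second fundamental form. -/
lemma exists_deriv_tangentProj {m N : ℕ} {M : Set (Euc N)} (hM : IsSmoothSubmanifold m M) (x : M) :
    ∃ D : Euc N → Euc N →L[ℝ] Euc N,
      (∀ a γ, IsCurveWithVelocity γ x a → HasDerivAt (fun t => tangentProj M (γ t)) (D a) 0) ∧
      (∀ a ∈ tangentSpace M x, ∀ b ∈ tangentSpace M x, tangentProj M x (D a b) = 0) ∧
      ∀ a ∈ tangentSpace M x, ∀ b ∈ tangentSpace M x, D a b = D b a := by
  obtain ⟨Φ, L, hx, hL, h1, h2, h3⟩ := hM x x.2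
  have hy : Φ x ∈ Φ.target := Φ.map_source hx
  have c1 : ContDiffAt ℝ ∞ Φ x := h1.contDiffAt (Φ.open_source.mem_nhds hx)
  have c2 : ContDiffAt ℝ ∞ Φ.symm (Φ x) := h2.contDiffAt (Φ.open_target.mem_nhds hy)
  have dΦ : DifferentiableAt ℝ Φ x := c1.differentiableAt (by simp)
  have dA : DifferentiableAt ℝ (fderiv ℝ Φ) x :=
    (c1.fderiv_right (m := 1) (by norm_cast)).differentiableAt (by simp)
  have dB : DifferentiableAt ℝ (fderiv ℝ Φ.symm) (Φ x) :=
    (c2.fderiv_right (m := 1) (by norm_cast)).differentiableAt (by simp)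
  have dBΦ : DifferentiableAt ℝ (fun z => fderiv ℝ Φ.symm (Φ z)) (x : Euc N) := dB.comp _ dΦ
  set E : Euc N → Euc N →L[ℝ] Euc N := fun z =>
    fderiv ℝ Φ.symm (Φ z) * L.starProjection * fderiv ℝ Φ z with hE
  have dE : DifferentiableAt ℝ E x := (dBΦ.mul_const _).mul dA
  set Q : Euc N → Euc N →L[ℝ] Euc N := fun z => E z * Ring.inverse (1 + E z - star (E z)) with hQ
  have dQ : DifferentiableAt ℝ Q x := by
    refine dE.mul (DifferentiableAt.inverse ?_ (isUnit_one_add_sub_star _))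
    exact (dE.const_add 1).sub dE.star
  have hPQ : ∀ y : M, (y : Euc N) ∈ Φ.source → tangentProj M y = Q y := by
    intro y hys
    obtain ⟨k1, k2, k3⟩ := chart_tangentSpace hM hL h1 h2 h3 y hys
    refine starProjection_eq_mul_inverse _ _ (fun b => ?_) fun a ha => ?_
    · exact k3 _ (L.starProjection_apply_mem _)
    · have e1 : L.starProjection (fderiv ℝ Φ y a) = fderiv ℝ Φ y a :=
        L.starProjection_eq_self_iff.2 (k2 a ha)
      have e2 : fderiv ℝ Φ.symm (Φ y) (fderiv ℝ Φ y a) = a := DFunLike.congr_fun k1 a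
      simp [hE, e1, e2]
  have hsrc : ∀ {a γ}, IsCurveWithVelocity γ x a → ∀ᶠ t in 𝓝 (0 : ℝ), (γ t : Euc N) ∈ Φ.source := by
    intro a γ hγ
    exact ((continuous_subtype_val.tendsto x).comp hγ.tendsto).eventually
      (Φ.open_source.mem_nhds hx)
  have hder : ∀ a γ, IsCurveWithVelocity γ x a →
      HasDerivAt (fun t => tangentProj M (γ t)) (fderiv ℝ Q x a) 0 := by
    intro a γ hγ
    have h0 : HasFDerivAt Q (fderiv ℝ Q x) ((fun t => (γ t : Euc N)) 0) := by
      simpa [hγ.1] using dQ.hasFDerivAt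
    refine (h0.comp_hasDerivAt 0 hγ.2).congr_of_eventuallyEq ?_
    filter_upwards [hsrc hγ] with t ht using hPQ _ ht
  have hPP : ∀ y : M, tangentProj M y * tangentProj M y = tangentProj M y := fun y =>
    (tangentSpace M y).isIdempotentElem_starProjection
  have hnormal : ∀ a ∈ tangentSpace M x, ∀ b ∈ tangentSpace M x,
      tangentProj M x (fderiv ℝ Q x a b) = 0 := by
    intro a ha b hb
    obtain ⟨γ, hγ⟩ := (mem_tangentSpace_iff hM x a).1 ha
    have hd := hder a γ hγ
    have e := (hd.mul hd).unique (hd.congr_of_eventuallyEq (.of_forall fun t => hPP (γ t)))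
    rw [hγ.1] at e
    have e' := DFunLike.congr_fun e b
    have hb' : tangentProj M x b = b := (tangentSpace M x).starProjection_eq_self_iff.2 hb
    simpa [hb'] using e'
  -- differentiate `P Y = Y` for the tangent field `Y = B(Φ y) (A b)` given by the chart
  have hsecond : ∀ a ∈ tangentSpace M x, ∀ b ∈ tangentSpace M x,
      fderiv ℝ Q x a b = (1 - tangentProj M x)
        (fderiv ℝ (fderiv ℝ Φ.symm) (Φ x) (fderiv ℝ Φ x a) (fderiv ℝ Φ x b)) := by
    intro a ha b hb
    obtain ⟨γ, hγ⟩ := (mem_tangentSpace_iff hM x a).1 ha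
    obtain ⟨k1, k2, k3⟩ := chart_tangentSpace hM hL h1 h2 h3 x hx
    have hd := hder a γ hγ
    have hΦγ : HasDerivAt (fun t => Φ (γ t)) (fderiv ℝ Φ x a) 0 := by
      have h0 : HasFDerivAt Φ (fderiv ℝ Φ x) ((fun t => (γ t : Euc N)) 0) := by
        simpa [hγ.1] using dΦ.hasFDerivAt
      exact h0.comp_hasDerivAt 0 hγ.2
    have hBγ : HasDerivAt (fun t => fderiv ℝ Φ.symm (Φ (γ t)))
        (fderiv ℝ (fderiv ℝ Φ.symm) (Φ x) (fderiv ℝ Φ x a)) 0 := by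
      have h0 : HasFDerivAt (fderiv ℝ Φ.symm) (fderiv ℝ (fderiv ℝ Φ.symm) (Φ x))
          ((fun t => Φ (γ t)) 0) := by
        simpa [hγ.1] using dB.hasFDerivAt
      exact h0.comp_hasDerivAt 0 hΦγ
    have hY : HasDerivAt (fun t => fderiv ℝ Φ.symm (Φ (γ t)) (fderiv ℝ Φ x b))
        (fderiv ℝ (fderiv ℝ Φ.symm) (Φ x) (fderiv ℝ Φ x a) (fderiv ℝ Φ x b)) 0 := by
      simpa using hBγ.clm_apply (hasDerivAt_const (0 : ℝ) (fderiv ℝ Φ x b))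
    have hPY := hd.clm_apply hY
    have hev : (fun t => tangentProj M (γ t) (fderiv ℝ Φ.symm (Φ (γ t)) (fderiv ℝ Φ x b)))
        =ᶠ[𝓝 0] fun t => fderiv ℝ Φ.symm (Φ (γ t)) (fderiv ℝ Φ x b) := by
      filter_upwards [hsrc hγ] with t ht
      exact (tangentSpace M (γ t)).starProjection_eq_self_iff.2
        ((chart_tangentSpace hM hL h1 h2 h3 (γ t) ht).2.2 _ (k2 b hb))
    have e := hPY.unique (hY.congr_of_eventuallyEq hev)
    have e2 : fderiv ℝ Φ.symm (Φ x) (fderiv ℝ Φ x b) = b := DFunLike.congr_fun k1 b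
    simp only [hγ.1, e2] at e
    rw [sub_apply, one_apply_eq_self]
    exact eq_sub_of_add_eq e
  refine ⟨fderiv ℝ Q x, hder, hnormal, fun a ha b hb => ?_⟩
  have hsymm : IsSymmSndFDerivAt ℝ Φ.symm (Φ x) :=
    c2.isSymmSndFDerivAt (by simpa using ENat.LEInfty.out)
  rw [hsecond a ha b hb, hsecond b hb a ha, hsymm.eq]

/-! ### The Gauss map near a point -/

/-- Orthonormal frame of the tangent space at `x`, indexed by the dimension of `M`. -/
def tangentFrame {m N : ℕ} {M : Set (Euc N)} (hM : IsSmoothSubmanifold m M) (x : M) :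
    OrthonormalBasis (Fin m) ℝ (tangentSpace M x) :=
  (frame M x).reindex (finCongr (finrank_tangentSpace hM x))

lemma sum_frame {m N : ℕ} {M : Set (Euc N)} (hM : IsSmoothSubmanifold m M) (x : M)
    {W : Type*} [AddCommMonoid W] (f : Euc N → W) :
    ∑ j, f (frame M x j) = ∑ j, f (tangentFrame hM x j) := by
  refine Fintype.sum_equiv (finCongr (finrank_tangentSpace hM x)) _ _ fun j => ?_
  simp [tangentFrame]

lemma orthonormal_tangentFrame {m N : ℕ} {M : Set (Euc N)} (hM : IsSmoothSubmanifold m M) (x : M) :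
    Orthonormal ℝ fun j => (tangentFrame hM x j : Euc N) :=
  (tangentFrame hM x).orthonormal.comp_linearIsometry (tangentSpace M x).subtypeₗᵢ

open Classical in
/-- The sign of the frame `tangentFrame hM x` with respect to the orientation `o x`. It makes sense
for `m = 0` too, where no frame represents the negative orientation. -/
def frameSign {m N : ℕ} {M : Set (Euc N)} (hM : IsSmoothSubmanifold m M)
    (o : ∀ x : M, Orientation ℝ (tangentSpace M x) (Fin m)) (x : M) : ℝ :=
  if (tangentFrame hM x).toBasis.orientation = o x then 1 else -1

lemma frameSign_mul_self {m N : ℕ} {M : Set (Euc N)} (hM : IsSmoothSubmanifold m M)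
    (o : ∀ x : M, Orientation ℝ (tangentSpace M x) (Fin m)) (x : M) :
    frameSign hM o x * frameSign hM o x = 1 := by
  rw [frameSign]; split_ifs <;> norm_num

lemma gaussMap_eq_frameSign_smul {m N : ℕ} {M : Set (Euc N)} (hM : IsSmoothSubmanifold m M)
    (o : ∀ x : M, Orientation ℝ (tangentSpace M x) (Fin m)) (x : M) :
    gaussMap hM o x = frameSign hM o x • wedge fun j => (tangentFrame hM x j : Euc N) := by
  classical
  rw [gaussMap, frameSign]
  change (if (tangentFrame hM x).toBasis.orientation = o x then _ else _) = _
  split_ifs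
  · rw [one_smul]; rfl
  · rw [neg_one_smul]; rfl

lemma wedge_eq_det_smul {m N : ℕ} {V : Submodule ℝ (Euc N)} (σ : OrthonormalBasis (Fin m) ℝ V)
    (v : Fin m → V) :
    wedge (fun j => (v j : Euc N)) = σ.toBasis.det v • wedge fun j => (σ j : Euc N) := by
  have h : wedgeAlt m V =
      (LinearMap.toSpanSingleton ℝ _ (wedgeAlt m V σ)).compAlternatingMap σ.toBasis.det := by
    refine Basis.ext_alternating σ.toBasis fun v hv => ?_
    obtain ⟨e, rfl⟩ : ∃ e : Equiv.Perm (Fin m), v = e :=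
      ⟨Equiv.ofBijective v (Finite.injective_iff_bijective.1 hv), rfl⟩
    have hd := AlternatingMap.map_perm σ.toBasis.det σ.toBasis e
    have hw := AlternatingMap.map_perm (wedgeAlt m V) σ.toBasis e
    rw [Basis.det_self] at hd
    simp only [Function.comp_def] at hd hw
    rw [LinearMap.compAlternatingMap_apply, hd, hw, OrthonormalBasis.coe_toBasis]
    rcases Int.units_eq_one_or (Equiv.Perm.sign e) with h1 | h1 <;> simp [h1]
  simpa [wedgeAlt_apply] using DFunLike.congr_fun h v

/-- The coordinates of the vectors `v` with respect to the tangent frame at `y`. -/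
def frameMatrix {m N : ℕ} {M : Set (Euc N)} (hM : IsSmoothSubmanifold m M) (v : Fin m → Euc N)
    (y : M) : Matrix (Fin m) (Fin m) ℝ :=
  Matrix.of fun i j => inner ℝ (tangentFrame hM y i : Euc N) (v j)

lemma frameMatrix_eq_toMatrix {m N : ℕ} {M : Set (Euc N)} (hM : IsSmoothSubmanifold m M) (y : M)
    (v : Fin m → tangentSpace M y) :
    frameMatrix hM (fun j => (v j : Euc N)) y = (tangentFrame hM y).toBasis.toMatrix v := by
  ext i j
  simp [frameMatrix, Basis.toMatrix_apply, OrthonormalBasis.repr_apply_apply]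

lemma inner_tangentProj {N : ℕ} {M : Set (Euc N)} (y : M) (a b : Euc N)
    (ha : a ∈ tangentSpace M y) : inner ℝ a (tangentProj M y b) = inner ℝ a b := by
  rw [tangentProj, ← (tangentSpace M y).inner_starProjection_left_eq_right,
    (tangentSpace M y).starProjection_eq_self_iff.2 ha]

lemma sum_inner_tangentFrame {m N : ℕ} {M : Set (Euc N)} (hM : IsSmoothSubmanifold m M) (y : M)
    (a b : Euc N) : ∑ k, inner ℝ (tangentFrame hM y k : Euc N) a *
      inner ℝ (tangentFrame hM y k : Euc N) b = inner ℝ a (tangentProj M y b) := by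
  have h := congrArg (Subtype.val) ((tangentFrame hM y).sum_repr'
    ⟨tangentProj M y b, (tangentSpace M y).starProjection_apply_mem b⟩)
  simp only [Submodule.coe_sum, Submodule.coe_smul, Submodule.coe_inner] at h
  conv_rhs => rw [← h]
  rw [inner_sum]
  refine Finset.sum_congr rfl fun k _ => ?_
  rw [inner_smul_right, inner_tangentProj y _ _ (tangentFrame hM y k).2, real_inner_comm a,
    mul_comm]

/-- The exterior product of the tangential projections of `m` vectors is a multiple of the Gauss
map; the factor is the determinant of their coordinates, with the sign of the frame. -/
lemma wedge_tangentProj {m N : ℕ} {M : Set (Euc N)} (hM : IsSmoothSubmanifold m M)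
    (o : ∀ x : M, Orientation ℝ (tangentSpace M x) (Fin m)) (y : M) (v : Fin m → Euc N) :
    wedge (fun j => tangentProj M y (v j)) =
      (frameSign hM o y * (frameMatrix hM v y).det) • gaussMap hM o y := by
  have h1 := wedge_eq_det_smul (tangentFrame hM y)
    fun j => ⟨tangentProj M y (v j), (tangentSpace M y).starProjection_apply_mem (v j)⟩
  have h2 : frameMatrix hM (fun j => tangentProj M y (v j)) y = frameMatrix hM v y := by
    ext i j
    exact inner_tangentProj y _ _ (tangentFrame hM y i).2
  have h3 := frameMatrix_eq_toMatrix hM y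
    fun j => ⟨tangentProj M y (v j), (tangentSpace M y).starProjection_apply_mem (v j)⟩
  simp only at h1 h3
  rw [h1, Basis.det_apply, ← h3, h2, gaussMap_eq_frameSign_smul, smul_smul, mul_right_comm,
    frameSign_mul_self, one_mul]

/-- Gram's identity for the projections of the vectors `v` to the tangent space. -/
lemma det_frameMatrix_sq {m N : ℕ} {M : Set (Euc N)} (hM : IsSmoothSubmanifold m M)
    (v : Fin m → Euc N) (y : M) :
    (frameMatrix hM v y).det ^ 2 =
      (Matrix.of fun j i => inner ℝ (v i) (tangentProj M y (v j))).det := by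
  rw [sq]
  nth_rewrite 1 [← Matrix.det_transpose]
  rw [← Matrix.det_mul]
  congr 1
  ext i j
  simp only [Matrix.mul_apply, Matrix.transpose_apply, frameMatrix, Matrix.of_apply]
  rw [sum_inner_tangentFrame, tangentProj,
    ← (tangentSpace M y).inner_starProjection_left_eq_right, real_inner_comm]

/-- Continuity of the orientation, in terms of the signs of the chosen orthonormal frames. -/
lemma IsOrientation.exists_frame {m N : ℕ} {M : Set (Euc N)} (hM : IsSmoothSubmanifold m M)
    {o : ∀ x : M, Orientation ℝ (tangentSpace M x) (Fin m)} (ho : IsOrientation M o) (x : M) :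
    ∃ (b : ∀ y : M, Basis (Fin m) ℝ (tangentSpace M y)) (ε : ℝ),
      (∀ i, ContinuousAt (fun y => (b y i : Euc N)) x) ∧
      ∀ᶠ y in 𝓝 x,
        0 < ε * frameSign hM o y * (frameMatrix hM (fun j => (b y j : Euc N)) y).det := by
  obtain ⟨U, hU, b, hb, hor⟩ := ho x
  have hne : ∀ y, (tangentFrame hM y).toBasis.det (b y) ≠ 0 := fun y =>
    (Basis.isUnit_det _ (b y)).ne_zero
  have hdet : ∀ y, (frameMatrix hM (fun j => (b y j : Euc N)) y).det =
      (tangentFrame hM y).toBasis.det (b y) := fun y => by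
    rw [frameMatrix_eq_toMatrix, Basis.det_apply]
  rcases hor with hor | hor
  · refine ⟨b, 1, fun i => (hb i).continuousAt hU, ?_⟩
    filter_upwards [hU] with y hy
    rw [hdet, frameSign]
    split_ifs with h
    · rw [hor y hy, Basis.orientation_eq_iff_det_pos] at h
      simpa using h
    · rw [hor y hy, Basis.orientation_eq_iff_det_pos] at h
      have := lt_of_le_of_ne (not_lt.1 h) (hne y)
      linarith
  · refine ⟨b, -1, fun i => (hb i).continuousAt hU, ?_⟩
    filter_upwards [hU] with y hy
    rw [hdet, frameSign]
    split_ifs with h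
    · rw [hor y hy, ← Basis.orientation_ne_iff_eq_neg, Ne,
        Basis.orientation_eq_iff_det_pos] at h
      have := lt_of_le_of_ne (not_lt.1 h) (hne y)
      linarith
    · rw [hor y hy, ← Basis.orientation_ne_iff_eq_neg, Ne, not_not,
        Basis.orientation_eq_iff_det_pos] at h
      simpa using h

lemma frameMatrix_tangentFrame {m N : ℕ} {M : Set (Euc N)} (hM : IsSmoothSubmanifold m M) (x : M) :
    frameMatrix hM (fun j => (tangentFrame hM x j : Euc N)) x = 1 := by
  rw [frameMatrix_eq_toMatrix, ← OrthonormalBasis.coe_toBasis, Basis.toMatrix_self]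

/-- The projection of an orthonormal frame at `x` to nearby tangent spaces keeps its orientation. -/
lemma eventually_frameSign_mul_det_pos {m N : ℕ} {M : Set (Euc N)} (hM : IsSmoothSubmanifold m M)
    {o : ∀ x : M, Orientation ℝ (tangentSpace M x) (Fin m)} (ho : IsOrientation M o) (x : M) :
    ∀ᶠ y in 𝓝 x, 0 < frameSign hM o x * (frameSign hM o y *
      (frameMatrix hM (fun j => (tangentFrame hM x j : Euc N)) y).det) := by
  obtain ⟨b, ε, hb, hpos⟩ := ho.exists_frame hM x
  set τ : Fin m → Euc N := fun j => tangentFrame hM x j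
  -- unlike the frames chosen above, the determinant of `⟪bᵢ, τⱼ⟫` is continuous
  set D : M → ℝ := fun y => (Matrix.of fun i j => inner ℝ (b y i : Euc N) (τ j)).det with hD
  have hDc : ContinuousAt D x := by
    have : ContinuousAt (fun y => Matrix.of fun i j => inner ℝ (b y i : Euc N) (τ j)) x :=
      continuousAt_pi.2 fun i => continuousAt_pi.2 fun j => (hb i).inner continuousAt_const
    exact (Continuous.matrix_det continuous_id).continuousAt.comp this
  have hDe : ∀ y, D y =
      (frameMatrix hM (fun j => (b y j : Euc N)) y).det * (frameMatrix hM τ y).det := by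
    intro y
    rw [← Matrix.det_transpose (frameMatrix hM (fun j => (b y j : Euc N)) y), ← Matrix.det_mul, hD]
    refine congrArg Matrix.det (Matrix.ext fun i j => ?_)
    simp only [Matrix.mul_apply, Matrix.transpose_apply, frameMatrix, Matrix.of_apply]
    rw [sum_inner_tangentFrame, inner_tangentProj _ _ _ (b y i).2]
  have key : ∀ y, frameSign hM o x * (ε * D y) =
      (ε * frameSign hM o y * (frameMatrix hM (fun j => (b y j : Euc N)) y).det) *
        (frameSign hM o x * (frameSign hM o y * (frameMatrix hM τ y).det)) := by
    intro y
    rw [hDe]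
    linear_combination (-(frameSign hM o x * ε * (frameMatrix hM (fun j => (b y j : Euc N)) y).det *
      (frameMatrix hM τ y).det)) * frameSign_mul_self hM o y
  have hx : 0 < frameSign hM o x * (ε * D x) := by
    rw [key, frameMatrix_tangentFrame, Matrix.det_one, mul_one, frameSign_mul_self, mul_one]
    exact hpos.self_of_nhds
  have hev : ∀ᶠ y in 𝓝 x, 0 < frameSign hM o x * (ε * D y) :=
    (continuousAt_const.mul (continuousAt_const.mul hDc)).eventually (lt_mem_nhds hx)
  filter_upwards [hev, hpos] with y h1 h2
  rw [key] at h1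
  exact (pos_iff_pos_of_mul_pos h1).1 h2

/-- Near `x`, the Gauss map is the normalized exterior product of the projections of an orthonormal
frame at `x`. -/
lemma eventually_gaussMap_eq {m N : ℕ} {M : Set (Euc N)} (hM : IsSmoothSubmanifold m M)
    {o : ∀ x : M, Orientation ℝ (tangentSpace M x) (Fin m)} (ho : IsOrientation M o) (x : M) :
    ∀ᶠ y in 𝓝 x, gaussMap hM o y = frameSign hM o x •
      (√(Matrix.of fun j i => inner ℝ (tangentFrame hM x i : Euc N)
        (tangentProj M y (tangentFrame hM x j))).det)⁻¹ •
        wedge fun j => tangentProj M y (tangentFrame hM x j) := by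
  filter_upwards [eventually_frameSign_mul_det_pos hM ho x] with y hy
  rw [← det_frameMatrix_sq hM (fun j => (tangentFrame hM x j : Euc N)) y, wedge_tangentProj hM o]
  set d := (frameMatrix hM (fun j => (tangentFrame hM x j : Euc N)) y).det
  have h1 := frameSign_mul_self hM o x
  have h2 := frameSign_mul_self hM o y
  have hd : √(d ^ 2) = frameSign hM o x * (frameSign hM o y * d) := by
    rw [← Real.sqrt_sq hy.le]
    congr 1
    linear_combination (-(d ^ 2 * frameSign hM o y * frameSign hM o y)) * h1 - d ^ 2 * h2
  rw [hd, smul_smul, smul_smul]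
  have : frameSign hM o x * ((frameSign hM o x * (frameSign hM o y * d))⁻¹ *
      (frameSign hM o y * d)) = 1 := by
    have h3 := inv_mul_cancel₀ hy.ne'
    linear_combination h3
  rw [← mul_assoc] at this
  rw [this, one_smul]

/-! ### The derivative of the Gauss map -/

/-- The determinant of the coordinates `⟪τᵢ, vⱼ⟫`, as a multilinear function of `v`. -/
def detInner {m N : ℕ} (τ : Fin m → Euc N) : MultilinearMap ℝ (fun _ : Fin m => Euc N) ℝ :=
  (Matrix.detRowAlternating (R := ℝ) (n := Fin m)).toMultilinearMap.compLinearMap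
    fun _ => LinearMap.pi fun i => innerₗ (Euc N) (τ i)

lemma detInner_apply {m N : ℕ} (τ v : Fin m → Euc N) :
    detInner τ v = (Matrix.of fun j i => inner ℝ (τ i) (v j)).det := rfl

lemma detInner_update_eq_zero {m N : ℕ} (τ v : Fin m → Euc N) (j : Fin m) (n : Euc N)
    (hn : ∀ i, inner ℝ (τ i) n = 0) : detInner τ (Function.update v j n) = 0 := by
  rw [detInner_apply]
  exact Matrix.det_eq_zero_of_row_eq_zero j fun i => by simp [hn]

/-- The Gauss map differentiates by the Leibniz rule: since the derivative of the tangent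
projection maps tangent vectors to normal ones, the normalization contributes nothing. -/
lemma hasDirDeriv_gaussMap {m N : ℕ} {M : Set (Euc N)} (hM : IsSmoothSubmanifold m M)
    {o : ∀ x : M, Orientation ℝ (tangentSpace M x) (Fin m)} (ho : IsOrientation M o) {x : M}
    {D : Euc N → Euc N →L[ℝ] Euc N}
    (hD : ∀ a γ, IsCurveWithVelocity γ x a → HasDerivAt (fun t => tangentProj M (γ t)) (D a) 0)
    (hn : ∀ a ∈ tangentSpace M x, ∀ b ∈ tangentSpace M x, tangentProj M x (D a b) = 0)
    {a : Euc N} (ha : a ∈ tangentSpace M x) :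
    HasDirDeriv (gaussMap hM o) x a (frameSign hM o x •
      ∑ j, wedge (Function.update (fun j => (tangentFrame hM x j : Euc N)) j
        (D a (tangentFrame hM x j)))) := by
  have : ContinuousAdd (Multivector N) := IsModuleTopology.toContinuousAdd ℝ (Multivector N)
  intro γ hγ
  set τ : Fin m → Euc N := fun j => tangentFrame hM x j with hτ
  set v : ℝ → Fin m → Euc N := fun t j => tangentProj M (γ t) (τ j) with hv
  have hτn : ∀ i j, inner ℝ (τ i) (D a (τ j)) = 0 := fun i j => by
    rw [← inner_tangentProj x _ _ (tangentFrame hM x i).2, hn a ha _ (tangentFrame hM x j).2,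
      inner_zero_right]
  have hv0 : v 0 = τ := by
    funext j
    simp only [hv, hγ.1]
    exact (tangentSpace M x).starProjection_eq_self_iff.2 (tangentFrame hM x j).2
  have hvd : ∀ j, HasDerivAt (fun t => v t j) (D a (τ j)) 0 := fun j => by
    simpa using (hD a γ hγ).clm_apply (hasDerivAt_const (0 : ℝ) (τ j))
  have hd0 : detInner τ (v 0) = 1 := by
    rw [hv0, detInner_apply, ← Matrix.det_one (n := Fin m)]
    refine congrArg Matrix.det (Matrix.ext fun i j => ?_)
    rw [Matrix.of_apply, orthonormal_iff_ite.1 (orthonormal_tangentFrame hM x), Matrix.one_apply]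
    simp only [eq_comm]
  have hd : HasDerivAt (fun t => detInner τ (v t)) 0 0 := by
    rw [hasDerivAt_iff_tendsto_slope_zero]
    simp only [zero_add]
    have h := tendsto_slope_multilinearMap (detInner τ) hvd
    rwa [Finset.sum_eq_zero fun j _ => detInner_update_eq_zero τ _ j _ fun i => hτn i j] at h
  have hs : HasDerivAt (fun t => (√(detInner τ (v t)))⁻¹) 0 0 := by
    have h := (hd.sqrt (by rw [hd0]; exact one_ne_zero)).fun_inv (by rw [hd0]; simp)
    simpa using h
  have hs' := hasDerivAt_iff_tendsto_slope_zero.1 hs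
  simp only [zero_add, hd0, Real.sqrt_one, inv_one] at hs'
  have hw := tendsto_slope_multilinearMap (wedgeMap m N).toMultilinearMap hvd
  simp only [AlternatingMap.coe_multilinearMap, wedgeMap_apply, hv0] at hw
  have ht : Tendsto (fun t : ℝ => t) (𝓝[≠] 0) (𝓝 0) := tendsto_nhdsWithin_of_tendsto_nhds tendsto_id
  have hwc : Tendsto (fun t => wedge (v t)) (𝓝[≠] 0) (𝓝 (wedge τ)) := by
    have h := (ht.smul hw).add_const (wedge τ)
    rw [zero_smul, zero_add] at h
    refine h.congr' ?_
    filter_upwards [self_mem_nhdsWithin] with t ht0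
    rw [smul_inv_smul₀ ht0, sub_add_cancel]
  have hprod := ((hs'.smul hwc).add hw).const_smul (frameSign hM o x)
  rw [zero_smul, zero_add] at hprod
  refine hprod.congr' ?_
  have hev := (hγ.tendsto.eventually (eventually_gaussMap_eq hM ho x)).filter_mono
    (nhdsWithin_le_nhds (s := {0}ᶜ))
  filter_upwards [hev] with t h
  have h0 : gaussMap hM o (γ 0) = frameSign hM o x • wedge τ := by
    rw [hγ.1, gaussMap_eq_frameSign_smul]
  have h1 : gaussMap hM o (γ t) = frameSign hM o x • (√(detInner τ (v t)))⁻¹ • wedge (v t) := h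
  rw [h0, h1, ← smul_sub, smul_comm (t⁻¹)]
  congr 1
  rw [smul_assoc, ← smul_add]
  congr 1
  rw [sub_smul, one_smul]
  abel

/-! ### The vector derivatives of the Gauss map -/

/-- With `H` the mean curvature vector, the Gauss map `G` satisfies `∂G = -H G` and
`G∂ = (-1)^(m+1) H G`. -/
lemma vectorDeriv_gaussMap {m N : ℕ} {M : Set (Euc N)} (hM : IsSmoothSubmanifold m M)
    {o : ∀ x : M, Orientation ℝ (tangentSpace M x) (Fin m)} (ho : IsOrientation M o) (x : M) :
    (∀ a ∈ tangentSpace M x, ∃ D, HasDirDeriv (gaussMap hM o) x a D) ∧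
    vectorDeriv (gaussMap hM o) x = -(vec (meanCurvature M x) * gaussMap hM o x) ∧
    rightVectorDeriv (gaussMap hM o) x =
      (-1 : ℝ) ^ (m + 1) • (vec (meanCurvature M x) * gaussMap hM o x) := by
  obtain ⟨D, hD, hn, hsymm⟩ := exists_deriv_tangentProj hM x
  set τ : Fin m → Euc N := fun j => tangentFrame hM x j with hτ
  have hτmem : ∀ j, τ j ∈ tangentSpace M x := fun j => (tangentFrame hM x j).2
  have hτo : Orthonormal ℝ τ := orthonormal_tangentFrame hM x
  have hnτ : ∀ k j i, inner ℝ (D (τ k) (τ j)) (τ i) = 0 := fun k j i => by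
    rw [real_inner_comm, ← inner_tangentProj x _ _ (hτmem i), hn _ (hτmem k) _ (hτmem j),
      inner_zero_right]
  have hII : ∀ k, secondFundamentalForm M x (τ k) (τ k) = D (τ k) (τ k) := by
    intro k
    have h : HasDirDeriv (fun y : M => tangentProj M y (τ k)) x (τ k) (D (τ k) (τ k)) := by
      intro γ hγ
      have h := hasDerivAt_iff_tendsto_slope_zero.1
        ((hD _ γ hγ).clm_apply (hasDerivAt_const (0 : ℝ) (τ k)))
      simpa using h
    rw [secondFundamentalForm, h.dirDeriv_eq hM (hτmem k), normalProj,
      Submodule.starProjection_eq_self_iff, ← Submodule.starProjection_apply_eq_zero_iff]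
    exact hn _ (hτmem k) _ (hτmem k)
  have hH : meanCurvature M x = ∑ k, D (τ k) (τ k) := by
    rw [meanCurvature, sum_frame hM x fun u => secondFundamentalForm M x u u]
    exact Finset.sum_congr rfl fun k _ => hII k
  have hG : gaussMap hM o x = frameSign hM o x • wedge τ := gaussMap_eq_frameSign_smul hM o x
  have hdir : ∀ k, dirDeriv (gaussMap hM o) x (τ k) =
      ∑ j, vec (D (τ k) (τ j)) * vec (τ j) * gaussMap hM o x := by
    intro k
    rw [(hasDirDeriv_gaussMap hM ho hD hn (hτmem k)).dirDeriv_eq hM (hτmem k), hG,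
      Finset.smul_sum]
    refine Finset.sum_congr rfl fun j _ => ?_
    rw [mul_smul_comm, ← wedge_update _ τ hτo (hnτ k j) j]
  have hsum := sum_sum_mul_vec_mul_vec τ hτo (fun k j => D (τ k) (τ j))
    fun k j => hsymm _ (hτmem k) _ (hτmem j)
  rw [← hH] at hsum
  -- exchanging the two tangent factors, by symmetry of the second fundamental form
  have hsum' : ∑ k, ∑ j, vec (D (τ k) (τ j)) * vec (τ k) * vec (τ j) =
      vec (meanCurvature M x) := by
    rw [← hsum, Finset.sum_comm]
    exact Finset.sum_congr rfl fun j _ => Finset.sum_congr rfl fun k _ => by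
      rw [hsymm _ (hτmem k) _ (hτmem j)]
  refine ⟨fun a ha => ⟨_, hasDirDeriv_gaussMap hM ho hD hn ha⟩, ?_, ?_⟩
  · rw [vectorDeriv, sum_frame hM x fun u => vec u * dirDeriv (gaussMap hM o) x u, ← hsum',
      Finset.sum_mul, ← Finset.sum_neg_distrib]
    refine Finset.sum_congr rfl fun k _ => ?_
    change vec (τ k) * dirDeriv (gaussMap hM o) x (τ k) = _
    rw [hdir, Finset.mul_sum, Finset.sum_mul, ← Finset.sum_neg_distrib]
    refine Finset.sum_congr rfl fun j _ => ?_
    rw [← mul_assoc, ← mul_assoc,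
      ← neg_eq_iff_eq_neg.2 (vec_mul_vec_of_inner_eq_zero (hnτ k j k))]
    simp only [neg_mul]
  · rw [rightVectorDeriv, sum_frame hM x fun u => dirDeriv (gaussMap hM o) x u * vec u, ← hsum,
      Finset.sum_mul, Finset.smul_sum]
    refine Finset.sum_congr rfl fun k _ => ?_
    change dirDeriv (gaussMap hM o) x (τ k) * vec (τ k) = _
    rw [hdir, Finset.sum_mul, Finset.sum_mul, Finset.smul_sum]
    refine Finset.sum_congr rfl fun j _ => ?_
    rw [hG, mul_assoc _ _ (vec (τ k)), smul_mul_assoc, wedge_mul_vec τ hτo k]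
    simp only [mul_smul_comm, mul_assoc]
    rw [smul_comm]

lemma vec_mul_gaussMap_eq_zero_iff {m N : ℕ} {M : Set (Euc N)} (hM : IsSmoothSubmanifold m M)
    (o : ∀ x : M, Orientation ℝ (tangentSpace M x) (Fin m)) (x : M) (a : Euc N) :
    vec a * gaussMap hM o x = 0 ↔ a = 0 := by
  have hs : frameSign hM o x ≠ 0 := fun h => by simpa [h] using frameSign_mul_self hM o x
  rw [gaussMap_eq_frameSign_smul, mul_smul_comm, smul_eq_zero_iff_right hs,
    (isUnit_wedge _ (orthonormal_tangentFrame hM x)).mul_left_eq_zero, vec_eq_zero_iff]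

end

end GeometricCalculus

theorem mainTheorem1 {m N : ℕ} (M : Set (GeometricCalculus.Euc N))
    (hM : GeometricCalculus.IsSmoothSubmanifold m M)
    (o : ∀ x : M, Orientation ℝ (GeometricCalculus.tangentSpace M x) (Fin m))
    (ho : GeometricCalculus.IsOrientation M o) :
    (GeometricCalculus.IsMinimal M ↔
      GeometricCalculus.IsMonogenic (GeometricCalculus.gaussMap hM o)) ∧
    (GeometricCalculus.IsMinimal M ↔
      GeometricCalculus.IsLeftMonogenic (GeometricCalculus.gaussMap hM o)) := by
  have h := GeometricCalculus.vectorDeriv_gaussMap hM ho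
  have hleft : GeometricCalculus.IsLeftMonogenic (GeometricCalculus.gaussMap hM o) →
      GeometricCalculus.IsMinimal M := fun hl x => by
    have hx := hl.2 x
    rwa [(h x).2.1, neg_eq_zero, GeometricCalculus.vec_mul_gaussMap_eq_zero_iff] at hx
  have hmono : GeometricCalculus.IsMinimal M →
      GeometricCalculus.IsMonogenic (GeometricCalculus.gaussMap hM o) := fun hmin =>
    ⟨fun x => (h x).1, fun x => by
      have hx := (GeometricCalculus.vec_mul_gaussMap_eq_zero_iff hM o x _).2 (hmin x)
      rw [(h x).2.1, (h x).2.2, hx]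
      simp⟩
  exact ⟨⟨hmono, fun hm => hleft ⟨hm.1, fun x => (hm.2 x).1⟩⟩,
    ⟨fun hmin => ⟨(hmono hmin).1, fun x => ((hmono hmin).2 x).1⟩, hleft⟩⟩
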